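/- Let $G$ be a finite group and let $\alpha:G^3\to U(1)$ be a normalized 3-cocycle, i.e. $\alpha(g_1,g_2,g_3)\,\alpha(g_0g_1,g_2,g_3)^{-1}\alpha(g_0,g_1g_2,g_3)\,\alpha(g_0,g_1,g_2g_3)^{-1}\alpha(g_0,g_1,g_2)=1$ for all $g_i\in G$, and $\alpha(1,g,h)=\alpha(g,1,h)=\alpha(g,h,1)=1$. Put $$\beta_a(b,c)=\frac{\alpha(a,b,c)\,\alpha(b,c,c^{-1}b^{-1}abc)}{\alpha(b,b^{-1}ab,c)},\qquad \eta^g(h,x)=\frac{\beta_g(x^{-1},xhx^{-1})}{\beta_g(h,x^{-1})}.$$ Let $Z_g$ be the centralizer of $g$. A $\beta_g$-representation of $Z_g$ is a map $\tilde\rho:Z_g\to GL_n(\mathbb C)$ with $\tilde\rho(h)\tilde\rho(k)=\beta_g(h,k)\tilde\rho(hk)$. For each conjugacy class $A$ of $G$ (as a set: $C^A$) fix a label set $I_A$ and, for every $g\in C^A$, a complete list $(\tilde\rho^g_\mu)_{\mu\in I_A}$ of pairwise inequivalent irreducible $\beta_g$-representations of $Z_g$, chosen such that the projective characters $\tilde\chi^g_\mu=\operatorname{tr}\tilde\rho^g_\mu$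 satisfy $\tilde\chi^{xgx^{-1}}_\mu(xhx^{-1})=\eta^g(h,x)\,\tilde\chi^g_\mu(h)$ for all $g\in C^A$, $h\in Z_g$, $x\in G$. Let $\mathcal H$ be the complex Hilbert space with orthonormal basis $|g,h\rangle$, where $g,h\in G$ and $gh=hg$. For $x\in G$ let $S^x$ be the linear operator on $\mathcal H$ with $$\begin{aligned}S^x|g,h\rangle={}&\alpha(xg^{-1}h^{-1},g,h)\,\alpha(xg^{-1}h^{-1},h,g)^{-1}\\ &\cdot\alpha(xh^{-1}x^{-1},xg^{-1},g)^{-1}\,\alpha(xgx^{-1},xg^{-1}h^{-1},h)^{-1}\\ &\cdot\alpha(xg^{-1}h^{-1}x^{-1},xgx^{-1},xg^{-1})\,\alpha(xgx^{-1},xg^{-1}h^{-1}x^{-1},x)^{-1}\\ &\cdot\alpha(xgx^{-1},xg^{-1}h^{-1}x^{-1},xgx^{-1})\;|xh^{-1}x^{-1},xgx^{-1}\rangle ,\end{aligned}$$ let $S=\frac1{|G|}\sum_{x\in G}S^x$, and let $$|A,\mu\rangle=\frac1{\sqrt{|G|}}\sum_{g\in C^A,\,h\in Z_g}\tilde\chi^g_\mu(h)\,|g,h\rangle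 .$$ Then for all conjugacy classes $A,B$ and all $\mu\in I_A$, $\nu\in I_B$, $$s_{(A\mu)(B\nu)}:=\langle A,\mu|S|B,\nu\rangle=\frac1{|G|}\sum_{\substack{g\in C^A,\;h\in C^B\\ gh=hg}}\overline{\tilde\chi^g_\mu(h)}\;\overline{\tilde\chi^h_\nu(g)} .$$ -/

import Mathlib

namespace TwistedDouble

universe u v

variable {G : Type u} [Group G]

/-- Normalized `U(1)`-valued 3-cocycles on `G` (trivial action). -/
structure IsNormalizedCocycle (α : G → G → G → Circle) : Prop where
  cocycle : ∀ g₀ g₁ g₂ g₃ : G,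
    α g₁ g₂ g₃ * (α (g₀ * g₁) g₂ g₃)⁻¹ * α g₀ (g₁ * g₂) g₃ *
      (α g₀ g₁ (g₂ * g₃))⁻¹ * α g₀ g₁ g₂ = 1
  one_left : ∀ g h : G, α 1 g h = 1
  one_mid : ∀ g h : G, α g 1 h = 1
  one_right : ∀ g h : G, α g h 1 = 1

/-- The function `β_a(b, c)`. -/
noncomputable def beta (α : G → G → G → Circle) (a b c : G) : Circle :=
  α a b c * α b c (c⁻¹ * b⁻¹ * a * b * c) / α b (b⁻¹ * a * b) c

/-- The phase `η^g(h, x)`. -/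
noncomputable def eta (α : G → G → G → Circle) (g h x : G) : Circle :=
  beta α g x⁻¹ (x * h * x⁻¹) / beta α g h x⁻¹

/-- A finite-dimensional complex `β_g`-representation of the centralizer of `g`, in matrix form.
The two laws force every `mat h` to be invertible. -/
structure ProjRep (α : G → G → G → Circle) (g : G) where
  dim : ℕ
  mat : Subgroup.centralizer ({g} : Set G) → Matrix (Fin dim) (Fin dim) ℂ
  map_one : mat 1 = 1
  map_mul : ∀ h k, mat h * mat k = (beta α g (h : G) (k : G) : ℂ) • mat (h * k)

namespace ProjRep

variable {α : G → G → G → Circle} {g : G}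

/-- Nonzero, without proper nonzero invariant subspaces. -/
def IsIrreducible (ρ : ProjRep α g) : Prop :=
  0 < ρ.dim ∧ ∀ W : Submodule ℂ (Fin ρ.dim → ℂ),
    (∀ h, ∀ w ∈ W, (ρ.mat h).mulVec w ∈ W) → W = ⊥ ∨ W = ⊤

/-- Equivalence of `β_g`-representations: an invertible intertwiner exists. -/
def Equivalent (ρ σ : ProjRep α g) : Prop :=
  ∃ P : (Fin ρ.dim → ℂ) ≃ₗ[ℂ] (Fin σ.dim → ℂ),
    ∀ h w, P ((ρ.mat h).mulVec w) = (σ.mat h).mulVec (P w)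

open Classical in
/-- The projective character `h ↦ tr ρ(h)` on the centralizer of `g`, as a function on `G`
that is set to `0` outside the centralizer. -/
noncomputable def character (ρ : ProjRep α g) (h : G) : ℂ :=
  if hh : h ∈ Subgroup.centralizer ({g} : Set G) then (ρ.mat ⟨h, hh⟩).trace else 0

end ProjRep

/-- A labelling `μ` of the irreducible projective representations, uniform along each conjugacy
class `A`: for every `g` in `A`, the `ρ^g_μ` form a complete list of pairwise inequivalent
irreducible `β_g`-representations of the centralizer of `g`, and the projective characters with
the same label transform by `η` under simultaneous conjugation. -/
structure IrrepSystem (α : G → G → G → Circle) where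
  Label : ConjClasses G → Type v
  rep : ∀ (A : ConjClasses G), Label A → ∀ g : G, ConjClasses.mk g = A → ProjRep α g
  irreducible : ∀ A μ g hg, (rep A μ g hg).IsIrreducible
  complete : ∀ A g hg (σ : ProjRep α g), σ.IsIrreducible → ∃! μ, (rep A μ g hg).Equivalent σ
  character_conj : ∀ A μ (g h x : G) (hg : ConjClasses.mk g = A)
    (hg' : ConjClasses.mk (x * g * x⁻¹) = A), g * h = h * g →
    (rep A μ (x * g * x⁻¹) hg').character (x * h * x⁻¹) =
      (eta α g h x : ℂ) * (rep A μ g hg).character h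

open Classical in
/-- `χ̃^g_μ(h)` for `g` in the class `A` and `h` in its centralizer (and `0` otherwise). -/
noncomputable def IrrepSystem.chi {α : G → G → G → Circle} (R : IrrepSystem.{u, v} α)
    {A : ConjClasses G} (μ : R.Label A) (g h : G) : ℂ :=
  if hg : ConjClasses.mk g = A then (R.rep A μ g hg).character h else 0

section Existence

variable {α : G → G → G → Circle}

theorem beta_cocycle (hα : IsNormalizedCocycle α) (a x y z : G) :
    beta α (x⁻¹ * a * x) y z * beta α a x (y * z) = beta α a (x * y) z * beta α a x y := by
  have h1 := congrArg Additive.ofMul (hα.cocycle a x y z)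
  have h2 := congrArg Additive.ofMul (hα.cocycle x (x⁻¹ * a * x) y z)
  have h3 := congrArg Additive.ofMul (hα.cocycle x y (y⁻¹ * x⁻¹ * a * x * y) z)
  have h4 := congrArg Additive.ofMul (hα.cocycle x y z (z⁻¹ * y⁻¹ * x⁻¹ * a * x * y * z))
  apply Additive.ofMul.injective
  simp only [beta, mul_inv_rev, ofMul_mul, ofMul_div, ofMul_inv, ofMul_one, mul_assoc,
    mul_inv_cancel_left, inv_mul_cancel_left] at *
  linear_combination (norm := module) h2 + h4 - h1 - h3

theorem beta_one_left (hα : IsNormalizedCocycle α) (a x : G) : beta α a 1 x = 1 := by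
  simp [beta, hα.one_left, hα.one_mid]

theorem beta_one_right (hα : IsNormalizedCocycle α) (a x : G) : beta α a x 1 = 1 := by
  simp [beta, hα.one_mid, hα.one_right]

theorem eta_one (hα : IsNormalizedCocycle α) (g h : G) : eta α g h 1 = 1 := by
  simp [eta, beta_one_left hα, beta_one_right hα]

theorem eta_comp (hα : IsNormalizedCocycle α) {g h : G} (hc : g * h = h * g) (x y : G) :
    eta α (x * g * x⁻¹) (x * h * x⁻¹) y * eta α g h x = eta α g h (y * x) := by
  have e : h⁻¹ * (g * h) = g := by rw [hc]; group
  have h1 := congrArg Additive.ofMul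
    (beta_cocycle hα g x⁻¹ y⁻¹ (y * (x * h * x⁻¹) * y⁻¹))
  have h2 := congrArg Additive.ofMul (beta_cocycle hα g h x⁻¹ y⁻¹)
  have h3 := congrArg Additive.ofMul (beta_cocycle hα g x⁻¹ (x * h * x⁻¹) y⁻¹)
  apply Additive.ofMul.injective
  simp only [eta, mul_inv_rev, inv_inv, ofMul_mul, ofMul_div, ofMul_inv, ofMul_one, mul_assoc,
    mul_inv_cancel_left, inv_mul_cancel_left, e] at *
  linear_combination (norm := module) h1 + h2 - h3

theorem eta_mul (hα : IsNormalizedCocycle α) {g h k : G} (hc : g * h = h * g) (x : G) :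
    eta α g h x * eta α g k x * beta α g h k =
      beta α (x * g * x⁻¹) (x * h * x⁻¹) (x * k * x⁻¹) * eta α g (h * k) x := by
  have e : h⁻¹ * (g * h) = g := by rw [hc]; group
  have h1 := congrArg Additive.ofMul (beta_cocycle hα g h k x⁻¹)
  have h2 := congrArg Additive.ofMul (beta_cocycle hα g h x⁻¹ (x * k * x⁻¹))
  have h3 := congrArg Additive.ofMul (beta_cocycle hα g x⁻¹ (x * h * x⁻¹) (x * k * x⁻¹))
  apply Additive.ofMul.injective
  simp only [eta, mul_inv_rev, inv_inv, ofMul_mul, ofMul_div, ofMul_inv, ofMul_one, mul_assoc,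
    mul_inv_cancel_left, inv_mul_cancel_left, e] at *
  linear_combination (norm := module) h2 - h1 - h3

theorem mem_cent {g h : G} : h ∈ Subgroup.centralizer ({g} : Set G) ↔ g * h = h * g := by
  rw [Subgroup.mem_centralizer_singleton_iff]
  exact eq_comm

theorem conj_mem_cent {g x g' : G} (e : g' = x * g * x⁻¹)
    (k : Subgroup.centralizer ({g'} : Set G)) :
    x⁻¹ * (k : G) * x ∈ Subgroup.centralizer ({g} : Set G) := by
  have := mem_cent.1 k.2
  rw [mem_cent]
  subst e
  calc g * (x⁻¹ * k * x) = x⁻¹ * (x * g * x⁻¹ * k) * x := by group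
    _ = x⁻¹ * (k * (x * g * x⁻¹)) * x := by rw [this]
    _ = x⁻¹ * k * x * g := by group

namespace ProjRep

/-- The `β_{g'}`-representation `x h x⁻¹ ↦ η^g(h, x) ρ(h)`, where `g' = x g x⁻¹`. -/
noncomputable def transport (hα : IsNormalizedCocycle α) {g g' : G} (ρ : ProjRep α g) (x : G)
    (e : g' = x * g * x⁻¹) : ProjRep α g' where
  dim := ρ.dim
  mat k := (eta α g (x⁻¹ * (k : G) * x) x : ℂ) • ρ.mat ⟨x⁻¹ * (k : G) * x, conj_mem_cent e k⟩
  map_one := by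
    have : (⟨x⁻¹ * ((1 : Subgroup.centralizer ({g'} : Set G)) : G) * x, conj_mem_cent e 1⟩ :
      Subgroup.centralizer ({g} : Set G)) = 1 := by ext; simp
    rw [this, ρ.map_one]
    simp [eta, beta_one_left hα, beta_one_right hα]
  map_mul h k := by
    have hc := mem_cent.1 (conj_mem_cent e h)
    have key := eta_mul (k := x⁻¹ * (k : G) * x) hα hc x
    have e1 : ∀ k : G, x * (x⁻¹ * k * x) * x⁻¹ = k := fun k => by group
    have e2 : x⁻¹ * (h : G) * x * (x⁻¹ * k * x) = x⁻¹ * ((h * k : _) : G) * x := by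
      push_cast; group
    rw [e1, e1, ← e, e2] at key
    have key' := congrArg (fun z : Circle => (z : ℂ)) key
    simp only [Circle.coe_mul] at key'
    rw [smul_mul_smul_comm, ρ.map_mul, smul_smul, smul_smul]
    rw [key']
    congr 2
    exact Subtype.ext e2

theorem character_transport (hα : IsNormalizedCocycle α) {g g' : G} (ρ : ProjRep α g) (x : G)
    (e : g' = x * g * x⁻¹) (k : G) (hk : g' * k = k * g') :
    (transport hα ρ x e).character k =
      (eta α g (x⁻¹ * k * x) x : ℂ) * ρ.character (x⁻¹ * k * x) := by
  rw [character, character, dif_pos (mem_cent.2 hk),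
    dif_pos (conj_mem_cent e ⟨k, mem_cent.2 hk⟩)]
  exact Matrix.trace_smul _ _

theorem character_self {g : G} (ρ : ProjRep α g) {h x : G}
    (hh : g * h = h * g) (hx : g * x = x * g) :
    ρ.character (x * h * x⁻¹) = (eta α g h x : ℂ) * ρ.character h := by
  have mh := mem_cent.2 hh
  have mx := mem_cent.2 hx
  have hmx := mul_mem (mul_mem mx mh) (inv_mem mx)
  rw [character, character, dif_pos mh, dif_pos hmx]
  set X : Subgroup.centralizer ({g} : Set G) := ⟨x, mx⟩
  set H : Subgroup.centralizer ({g} : Set G) := ⟨h, mh⟩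
  have eK : (⟨x * h * x⁻¹, hmx⟩ : Subgroup.centralizer ({g} : Set G)) = X * H * X⁻¹ := rfl
  rw [eK]
  have m1 := ρ.map_mul X⁻¹ (X * H * X⁻¹)
  have m2 := ρ.map_mul H X⁻¹
  have m3 := ρ.map_mul X⁻¹ X
  rw [show X⁻¹ * (X * H * X⁻¹) = H * X⁻¹ by group] at m1
  rw [inv_mul_cancel, ρ.map_one] at m3
  have hb : (beta α g (H : G) ((X⁻¹ : _) : G) : ℂ) ≠ 0 := Circle.coe_ne_zero _
  have hb3 : (beta α g ((X⁻¹ : _) : G) (X : G) : ℂ) ≠ 0 := Circle.coe_ne_zero _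
  have m4 : ρ.mat X⁻¹ * ρ.mat (X * H * X⁻¹) = (eta α g h x : ℂ) • (ρ.mat H * ρ.mat X⁻¹) := by
    rw [m1, m2, smul_smul, eta, Circle.coe_div]
    congr 1
    change _ = (beta α g x⁻¹ (x * h * x⁻¹) : ℂ) / (beta α g h x⁻¹ : ℂ) * beta α g h x⁻¹
    rw [div_mul_cancel₀ _ (Circle.coe_ne_zero _)]
    rfl
  have m5 : ρ.mat X⁻¹ * ((beta α g ((X⁻¹ : _) : G) (X : G) : ℂ)⁻¹ • ρ.mat X) = 1 := by
    rw [mul_smul_comm, m3, smul_smul, inv_mul_cancel₀ hb3, one_smul]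
  have m6 := mul_eq_one_comm.1 m5
  set Y := ((beta α g ((X⁻¹ : _) : G) (X : G) : ℂ)⁻¹ • ρ.mat X)
  calc (ρ.mat (X * H * X⁻¹)).trace = (Y * (ρ.mat X⁻¹ * ρ.mat (X * H * X⁻¹))).trace := by
        rw [← mul_assoc, m6, one_mul]
    _ = (eta α g h x : ℂ) * (Y * (ρ.mat H * ρ.mat X⁻¹)).trace := by
        rw [m4, mul_smul_comm, Matrix.trace_smul, smul_eq_mul]
    _ = _ := by rw [Matrix.trace_mul_comm, mul_assoc, m5, mul_one]

theorem Equivalent.refl {g : G} (ρ : ProjRep α g) : ρ.Equivalent ρ := ⟨LinearEquiv.refl _ _, fun _ _ => rfl⟩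

theorem Equivalent.symm {g : G} {ρ σ : ProjRep α g} (h : ρ.Equivalent σ) : σ.Equivalent ρ := by
  obtain ⟨P, hP⟩ := h
  exact ⟨P.symm, fun h w => by rw [P.symm_apply_eq, hP, P.apply_symm_apply]⟩

theorem Equivalent.trans {g : G} {ρ σ τ : ProjRep α g} (h : ρ.Equivalent σ)
    (k : σ.Equivalent τ) : ρ.Equivalent τ := by
  obtain ⟨P, hP⟩ := h
  obtain ⟨Q, hQ⟩ := k
  exact ⟨P.trans Q, fun h w => by simp [hP, hQ]⟩

theorem Equivalent.transport (hα : IsNormalizedCocycle α) {g g' : G} {ρ σ : ProjRep α g}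
    (h : ρ.Equivalent σ) (x : G) (e : g' = x * g * x⁻¹) :
    (ρ.transport hα x e).Equivalent (σ.transport hα x e) := by
  obtain ⟨P, hP⟩ := h
  refine ⟨P, fun k (w : Fin ρ.dim → ℂ) => ?_⟩
  have hs : ∀ (c : ℂ) h, P ((c • ρ.mat h).mulVec w) = (c • σ.mat h).mulVec (P w) := fun c h => by
    rw [Matrix.smul_mulVec, Matrix.smul_mulVec, ← hP, map_smul]
  exact hs _ _

theorem transport_transport (hα : IsNormalizedCocycle α) {g g' : G} (ρ : ProjRep α g) (x y : G)
    (e : g' = x * g * x⁻¹) (e' : g = y * g' * y⁻¹) (hy : y * x = 1) :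
    ((ρ.transport hα x e).transport hα y e').Equivalent ρ := by
  obtain rfl : y = x⁻¹ := eq_inv_of_mul_eq_one_left hy
  refine ⟨LinearEquiv.refl _ _, fun k w => ?_⟩
  have hk := mem_cent.1 k.2
  have key := eta_comp hα hk x x⁻¹
  have hx : ∀ k : G, x⁻¹ * (x * k * x⁻¹) * x = k := fun k => by group
  rw [inv_mul_cancel, eta_one hα, ← e] at key
  have key' := congrArg (fun z : Circle => (z : ℂ)) key
  simp only [Circle.coe_mul, Circle.coe_one] at key'
  simp only [ProjRep.transport, inv_inv, smul_smul, hx, key', one_smul]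
  rfl

theorem IsIrreducible.transport (hα : IsNormalizedCocycle α) {g g' : G} {ρ : ProjRep α g}
    (h : ρ.IsIrreducible) (x : G) (e : g' = x * g * x⁻¹) :
    (ρ.transport hα x e).IsIrreducible := by
  refine ⟨h.1, fun W hW => h.2 W fun k w hw => ?_⟩
  have m : x * (k : G) * x⁻¹ ∈ Subgroup.centralizer ({g'} : Set G) := by
    have := mem_cent.1 k.2
    rw [mem_cent, e]
    calc x * g * x⁻¹ * (x * k * x⁻¹) = x * (g * k) * x⁻¹ := by group
      _ = x * (k * g) * x⁻¹ := by rw [this]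
      _ = x * k * x⁻¹ * (x * g * x⁻¹) := by group
  have h1 := hW ⟨_, m⟩ w hw
  have hx : ∀ k : G, x⁻¹ * (x * k * x⁻¹) * x = k := fun k => by group
  simp only [ProjRep.transport, hx] at h1
  have h2 : (eta α g k x : ℂ) • (ρ.mat k).mulVec w ∈ W := by
    rw [← Matrix.smul_mulVec]; exact h1
  exact (W.smul_mem_iff (Circle.coe_ne_zero _)).1 h2

end ProjRep

open ProjRep

/-- Such labellings exist for every normalized 3-cocycle. -/
theorem IrrepSystem.nonempty (hα : IsNormalizedCocycle α) : Nonempty (IrrepSystem.{u, u} α) := by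
  let rp : ConjClasses G → G := Quotient.out
  have hrp : ∀ A, ConjClasses.mk (rp A) = A := Quotient.out_eq
  have ht : ∀ g : G, ∃ t : G, g = t * rp (ConjClasses.mk g) * t⁻¹ := fun g => by
    obtain ⟨t, h⟩ := isConj_iff.1 (ConjClasses.mk_eq_mk_iff_isConj.1 (hrp (ConjClasses.mk g)))
    exact ⟨t, h.symm⟩
  choose t ht using ht
  let s : ∀ A, Setoid {ρ : ProjRep α (rp A) // ρ.IsIrreducible} := fun A =>
    { r := fun ρ σ => ρ.1.Equivalent σ.1
      iseqv := ⟨fun ρ => .refl ρ.1, fun h => h.symm, fun h k => h.trans k⟩ }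
  have ht' : ∀ A (g : G), ConjClasses.mk g = A → g = t g * rp A * (t g)⁻¹ := by
    rintro A g rfl; exact ht g
  have ht'' : ∀ A (g : G), ConjClasses.mk g = A → rp A = (t g)⁻¹ * g * (t g)⁻¹⁻¹ := by
    intro A g hg
    have := ht' A g hg
    rw [inv_inv, eq_comm]
    calc (t g)⁻¹ * g * t g = (t g)⁻¹ * (t g * rp A * (t g)⁻¹) * t g := by rw [← this]
      _ = rp A := by group
  refine ⟨⟨fun A => Quotient (s A), fun A μ g hg => μ.out.1.transport hα (t g) (ht' A g hg),
    fun A μ g hg => μ.out.2.transport hα _ _, ?_, ?_⟩⟩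
  · intro A g hg σ hσ
    let τ : {ρ : ProjRep α (rp A) // ρ.IsIrreducible} :=
      ⟨σ.transport hα (t g)⁻¹ (ht'' A g hg), hσ.transport hα _ _⟩
    refine ⟨Quotient.mk (s A) τ, ?_, fun ν hν => ?_⟩
    · have h1 : (Quotient.mk (s A) τ).out.1.Equivalent τ.1 := Quotient.mk_out (s := s A) τ
      exact (h1.transport hα (t g) (ht' A g hg)).trans
        (transport_transport hα σ _ _ (ht'' A g hg) (ht' A g hg) (mul_inv_cancel _))
    · rw [← Quotient.out_eq ν]
      apply Quotient.sound (s := s A)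
      have h1 := Equivalent.transport hα hν (t g)⁻¹ (ht'' A g hg)
      exact (transport_transport hα _ _ _ _ _ (inv_mul_cancel _)).symm.trans h1
  · intro A μ g h x hg hg' hc
    let g' := x * g * x⁻¹
    have eg' : g' = x * g * x⁻¹ := rfl
    let a := rp A
    have e1 := ht' A g hg
    have e2 := ht' A g' hg'
    have hc' : g' * (x * h * x⁻¹) = x * h * x⁻¹ * g' := by
      calc g' * (x * h * x⁻¹) = x * (g * h) * x⁻¹ := by rw [eg']; group
        _ = x * (h * g) * x⁻¹ := by rw [hc]
        _ = _ := by rw [eg']; group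
    refine (character_transport hα μ.out.1 _ e2 _ hc').trans
      (.trans ?_ (congrArg _ (character_transport hα μ.out.1 _ e1 _ hc).symm))
    set k := (t g)⁻¹ * h * t g with hk
    set y := (t g')⁻¹ * x * t g with hy
    have ck : a * k = k * a := mem_cent.1 (conj_mem_cent e1 ⟨h, mem_cent.2 hc⟩)
    have ey : y * a * y⁻¹ = a := by
      have e3 := ht'' A g' hg'
      have : g' = x * (t g * a * (t g)⁻¹) * x⁻¹ := by rw [← e1]
      calc y * a * y⁻¹ = (t g')⁻¹ * (x * (t g * a * (t g)⁻¹) * x⁻¹) * t g' := by rw [hy]; group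
        _ = a := by rw [← this]; rw [inv_inv] at e3; exact e3.symm
    have cy : a * y = y * a := by
      calc a * y = y * a * y⁻¹ * y := by rw [ey]
        _ = y * a := by group
    have ek : (t g')⁻¹ * (x * h * x⁻¹) * t g' = y * k * y⁻¹ := by rw [hy, hk]; group
    rw [ek, character_self μ.out.1 ck cy]
    have c1 := eta_comp hα ck y (t g')
    have c2 := eta_comp hα ck (t g) x
    rw [ey, show t g' * y = x * t g by rw [hy]; group] at c1
    rw [← e1, show t g * k * (t g)⁻¹ = h by rw [hk]; group] at c2
    have c3 := congrArg (fun z : Circle => (z : ℂ)) (c1.trans c2.symm)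
    simp only [Circle.coe_mul] at c3
    rw [← mul_assoc, c3, mul_assoc]

end Existence

/-- Commuting pairs `(g, h)`: the flat configurations on the one-vertex triangulated torus. -/
abbrev CommPair (G : Type u) [Group G] : Type u := {p : G × G // p.1 * p.2 = p.2 * p.1}

/-- The commuting pair `(x h⁻¹ x⁻¹, x g x⁻¹)`. -/
def sTarget (x : G) (p : CommPair G) : CommPair G :=
  ⟨(x * p.1.2⁻¹ * x⁻¹, x * p.1.1 * x⁻¹), by
    have h : p.1.2⁻¹ * p.1.1 = p.1.1 * p.1.2⁻¹ :=
      ((show Commute p.1.1 p.1.2 from p.2).inv_right.eq).symm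
    calc x * p.1.2⁻¹ * x⁻¹ * (x * p.1.1 * x⁻¹) = x * (p.1.2⁻¹ * p.1.1) * x⁻¹ := by group
      _ = x * (p.1.1 * p.1.2⁻¹) * x⁻¹ := by rw [h]
      _ = x * p.1.1 * x⁻¹ * (x * p.1.2⁻¹ * x⁻¹) := by group⟩

/-- The product of 3-cocycles in the action of `S^x` on `|g, h⟩`. -/
noncomputable def sPhase (α : G → G → G → Circle) (x g h : G) : Circle :=
  α (x * g⁻¹ * h⁻¹) g h * (α (x * g⁻¹ * h⁻¹) h g)⁻¹ *
  (α (x * h⁻¹ * x⁻¹) (x * g⁻¹) g)⁻¹ * (α (x * g * x⁻¹) (x * g⁻¹ * h⁻¹) h)⁻¹ *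
  α (x * g⁻¹ * h⁻¹ * x⁻¹) (x * g * x⁻¹) (x * g⁻¹) *
  (α (x * g * x⁻¹) (x * g⁻¹ * h⁻¹ * x⁻¹) x)⁻¹ *
  α (x * g * x⁻¹) (x * g⁻¹ * h⁻¹ * x⁻¹) (x * g * x⁻¹)

variable [Fintype G] [DecidableEq G]

/-- The space with orthonormal basis `|g, h⟩`, `gh = hg` (the flat subspace on the torus). -/
abbrev TorusSpace (G : Type u) [Group G] [Fintype G] [DecidableEq G] : Type u :=
  EuclideanSpace ℂ (CommPair G)

/-- The basis vector `|g, h⟩`. -/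
noncomputable def basisKet (p : CommPair G) : TorusSpace G := EuclideanSpace.single p 1

/-- The operator `S^x`. -/
noncomputable def sOpAt (α : G → G → G → Circle) (x : G) : TorusSpace G →ₗ[ℂ] TorusSpace G :=
  (EuclideanSpace.basisFun (CommPair G) ℂ).toBasis.constr ℂ fun p =>
    (sPhase α x p.1.1 p.1.2 : ℂ) • basisKet (sTarget x p)

/-- The modular operator `S = |G|⁻¹ ∑_x S^x`. -/
noncomputable def sOp (α : G → G → G → Circle) : TorusSpace G →ₗ[ℂ] TorusSpace G :=
  (1 / (Fintype.card G : ℂ)) • ∑ x : G, sOpAt α x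

/-- The ground-state basis vector `|A, μ⟩`. -/
noncomputable def IrrepSystem.ket {α : G → G → G → Circle} (R : IrrepSystem.{u, v} α)
    {A : ConjClasses G} (μ : R.Label A) : TorusSpace G :=
  (1 / (Real.sqrt (Fintype.card G : ℝ) : ℂ)) •
    ∑ p : CommPair G with ConjClasses.mk p.1.1 = A, R.chi μ p.1.1 p.1.2 • basisKet p

/-- The matrix element `s_{(Aμ)(Bν)} = ⟨A, μ| S |B, ν⟩`. -/
noncomputable def IrrepSystem.sMatrix {α : G → G → G → Circle} (R : IrrepSystem.{u, v} α)
    {A B : ConjClasses G} (μ : R.Label A) (ν : R.Label B) : ℂ :=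
  inner ℂ (R.ket μ) (sOp α (R.ket ν))

end TwistedDouble

namespace TwistedDouble

universe u v

/-! The operator $S^x$ simultaneously conjugates a commuting pair by $x$ and exchanges its entries,
up to inversion. The theorem holds because its phase is exactly the factor that such a move produces
in a projective character.

Put $g'=xgx^{-1}$ and $k=xh^{-1}x^{-1}$. Conjugation covariance gives
$\tilde\chi^{g'}(k^{-1})=\eta^g(h,x)\,\tilde\chi^g(h)$. An invariant Hermitian form gives
$\tilde\chi^{g'}(k^{-1})=\beta_{g'}(k,k^{-1})\,\overline{\tilde\chi^{g'}(k)}$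
(`ProjRep.character_inv`). The phase of $S^x$ is $\eta^g(h,x)/\beta_{g'}(k,k^{-1})$
(`sPhase_mul_beta`), so the phase times $\tilde\chi^g(h)$ equals $\overline{\tilde\chi^{g'}(k)}$
(`IrrepSystem.sPhase_mul_chi`).

The target of $S^x|g,h\rangle$ is $|k,g'\rangle$, and this correspondence permutes the commuting
pairs. Hence $S^x|B,\nu\rangle$ does not depend on $x$, averaging over $x$ changes nothing, and
orthonormality of the $|g,h\rangle$ yields the formula. -/

/-- The phase of `S^x` expressed through `β` and `η`. -/
theorem sPhase_mul_beta {G : Type u} [Group G] {α : G → G → G → Circle}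
    (hα : IsNormalizedCocycle α) {g h : G} (hc : g * h = h * g) (x : G) :
    sPhase α x g h * beta α (x * g * x⁻¹) (x * h⁻¹ * x⁻¹) (x * h * x⁻¹) = eta α g h x := by
  have c : Commute h g := hc.symm
  have c1 : ∀ z, h * (g * z) = g * (h * z) := c.left_comm
  have c2 : ∀ z, h⁻¹ * (g * z) = g * (h⁻¹ * z) := c.inv_left.left_comm
  have d1 : h * g = g * h := c
  have d2 : h⁻¹ * g = g * h⁻¹ := c.inv_left
  have d4 : h⁻¹ * g⁻¹ = g⁻¹ * h⁻¹ := c.inv_inv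
  have cc := fun g₀ g₁ g₂ g₃ => congrArg Additive.ofMul (hα.cocycle g₀ g₁ g₂ g₃)
  -- In additive notation the identity is a combination, with coefficients ±1, of these thirteen
  -- cocycle conditions. Words are normalised by moving `g` to the left of `h`, and terms with a
  -- trivial first or middle argument vanish.
  have h1 := cc (x * g * x⁻¹) (x * g⁻¹ * h⁻¹ * x⁻¹) (x * g * x⁻¹) (x * h * x⁻¹)
  have h2 := cc (x * g * x⁻¹) (x * g⁻¹ * h⁻¹ * x⁻¹) x (g * h * x⁻¹)
  have h3 := cc (x * g⁻¹ * h⁻¹ * x⁻¹) (x * g * x⁻¹) (x * g⁻¹) (g * h * x⁻¹)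
  have h4 := cc (x * h⁻¹ * x⁻¹) x (h * x⁻¹) (x * g * x⁻¹)
  have h5 := cc (x * h⁻¹ * x⁻¹) (x * g⁻¹) g (h * x⁻¹)
  have h6 := cc (x * g⁻¹ * h⁻¹) g h x⁻¹
  have h7 := cc (x * h⁻¹) h x⁻¹ (x * g * x⁻¹)
  have h8 := cc (x * g * x⁻¹) (x * g⁻¹ * h⁻¹) h (g * x⁻¹)
  have h9 := cc (x * g⁻¹ * h⁻¹) h g x⁻¹
  have h10 := cc (x * g⁻¹) g x⁻¹ (x * h * x⁻¹)
  have h11 := cc x x⁻¹ (x * h * x⁻¹) (x * g * x⁻¹)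
  have h12 := cc x x⁻¹ (x * g * x⁻¹) (x * h * x⁻¹)
  have h13 := cc (x * g * x⁻¹) (x * g⁻¹) (g * x⁻¹) (x * h * x⁻¹)
  clear cc hc c
  apply Additive.ofMul.injective
  simp only [sPhase, beta, eta, mul_inv_rev, inv_inv, mul_assoc, mul_inv_cancel_left,
    inv_mul_cancel_left, mul_inv_cancel, inv_mul_cancel, mul_one, one_mul, inv_one, c1, c2,
    d1, d2, d4, hα.one_left, hα.one_mid, ofMul_mul, ofMul_div, ofMul_inv,
    ofMul_one] at h1 h2 h3 h4 h5 h6 h7 h8 h9 h10 h11 h12 h13 ⊢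
  linear_combination (norm := module) h1 - h2 + h3 + h4 - h5 + h6 + h7 - h8 - h9 - h10 - h11 + h12 + h13

/-! ### Projective characters under inversion and conjugation -/

open scoped ComplexOrder in
theorem ProjRep.character_inv {G : Type u} [Group G] [Finite G] {α : G → G → G → Circle} {g : G}
    (ρ : ProjRep α g) {k : G} (hk : g * k = k * g) :
    ρ.character k⁻¹ = (beta α g k k⁻¹ : ℂ) * starRingEnd ℂ (ρ.character k) := by
  have mk := mem_cent.2 hk
  rw [character, character, dif_pos mk, dif_pos (inv_mem mk)]
  set K : Subgroup.centralizer ({g} : Set G) := ⟨k, mk⟩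
  change (ρ.mat K⁻¹).trace = _
  have := Fintype.ofFinite (Subgroup.centralizer ({g} : Set G))
  -- Weyl's averaging trick: the term at `h = 1` is the identity matrix, and the others are positive
  -- semidefinite.
  have hH : (∑ h, (ρ.mat h).conjTranspose * ρ.mat h).PosDef := by
    classical
    rw [← Finset.add_sum_erase _ _ (Finset.mem_univ 1)]
    refine Matrix.PosDef.add_posSemidef ?_ (Matrix.posSemidef_sum _ fun h _ =>
      Matrix.posSemidef_conjTranspose_mul_self _)
    rw [ρ.map_one, Matrix.conjTranspose_one, one_mul]
    exact Matrix.PosDef.one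
  have hinv : (ρ.mat K).conjTranspose * (∑ h, (ρ.mat h).conjTranspose * ρ.mat h) * ρ.mat K =
      ∑ h, (ρ.mat h).conjTranspose * ρ.mat h := by
    rw [Finset.mul_sum, Finset.sum_mul]
    refine Fintype.sum_equiv (Equiv.mulRight K) _ _ fun h => ?_
    have e : (ρ.mat K).conjTranspose * ((ρ.mat h).conjTranspose * ρ.mat h) * ρ.mat K =
        (ρ.mat h * ρ.mat K).conjTranspose * (ρ.mat h * ρ.mat K) := by
      rw [Matrix.conjTranspose_mul]; simp only [mul_assoc]
    rw [e, ρ.map_mul, Matrix.conjTranspose_smul, smul_mul_smul_comm, Equiv.coe_mulRight]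
    -- The multiplier has modulus 1, so it drops out of the Hermitian form.
    rw [RCLike.star_def, ← Complex.normSq_eq_conj_mul_self]
    simp
  set H := ∑ h, (ρ.mat h).conjTranspose * ρ.mat h
  have m := ρ.map_mul K K⁻¹
  rw [mul_inv_cancel, ρ.map_one] at m
  -- Invariance of `H`, multiplied on the right by `ρ.mat K⁻¹`. Up to the multiplier, `ρ.mat K⁻¹` is
  -- thus similar to the adjoint of `ρ.mat K`.
  have e : H * ρ.mat K⁻¹ = (beta α g k k⁻¹ : ℂ) • ((ρ.mat K).conjTranspose * H) := by
    calc H * ρ.mat K⁻¹ = (ρ.mat K).conjTranspose * H * (ρ.mat K * ρ.mat K⁻¹) := by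
          nth_rw 1 [← hinv]; simp only [mul_assoc]
      _ = _ := by rw [m, mul_smul_comm, mul_one]; rfl
  have hu : IsUnit H.det := (Matrix.isUnit_iff_isUnit_det H).1 hH.isUnit
  calc (ρ.mat K⁻¹).trace = (H⁻¹ * (H * ρ.mat K⁻¹)).trace := by
        rw [Matrix.nonsing_inv_mul_cancel_left _ _ hu]
    _ = _ := by
        rw [e, mul_smul_comm, Matrix.trace_smul, Matrix.trace_mul_comm,
          Matrix.mul_nonsing_inv_cancel_right _ _ hu, Matrix.trace_conjTranspose, smul_eq_mul]
        rfl

variable {G : Type u} [Group G] {α : G → G → G → Circle}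

theorem IrrepSystem.chi_eq_zero (R : IrrepSystem.{u, v} α) {A : ConjClasses G} (μ : R.Label A)
    {g : G} (hg : ConjClasses.mk g ≠ A) (h : G) : R.chi μ g h = 0 := dif_neg hg

/-- Off the class `A` both sides are the default value 0, so no class hypothesis is needed and the
identity applies termwise in sums over all commuting pairs. -/
theorem IrrepSystem.chi_conj (R : IrrepSystem.{u, v} α) {A : ConjClasses G} (μ : R.Label A)
    {g h : G} (hc : g * h = h * g) (x : G) :
    R.chi μ (x * g * x⁻¹) (x * h * x⁻¹) = (eta α g h x : ℂ) * R.chi μ g h := by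
  have e : ConjClasses.mk (x * g * x⁻¹) = ConjClasses.mk g :=
    ConjClasses.mk_eq_mk_iff_isConj.2 (isConj_iff.2 ⟨x⁻¹, by group⟩)
  by_cases hg : ConjClasses.mk g = A
  · rw [chi, chi, dif_pos hg, dif_pos (e.trans hg)]
    exact R.character_conj A μ g h x hg (e.trans hg) hc
  · rw [R.chi_eq_zero μ hg, R.chi_eq_zero μ (e ▸ hg), mul_zero]

theorem IrrepSystem.chi_inv [Finite G] (R : IrrepSystem.{u, v} α)
    {A : ConjClasses G} (μ : R.Label A) {g h : G} (hc : g * h = h * g) :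
    R.chi μ g h⁻¹ = (beta α g h h⁻¹ : ℂ) * starRingEnd ℂ (R.chi μ g h) := by
  by_cases hg : ConjClasses.mk g = A
  · rw [chi, chi, dif_pos hg, dif_pos hg, ProjRep.character_inv _ hc]
  · rw [R.chi_eq_zero μ hg, R.chi_eq_zero μ hg, map_zero, mul_zero]

/-- Multiplying a character by the phase of `S^x` conjugates it and swaps the arguments. -/
theorem IrrepSystem.sPhase_mul_chi [Finite G] (hα : IsNormalizedCocycle α)
    (R : IrrepSystem.{u, v} α) {A : ConjClasses G} (μ : R.Label A) (x : G) (p : CommPair G) :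
    (sPhase α x p.1.1 p.1.2 : ℂ) * R.chi μ p.1.1 p.1.2 =
      starRingEnd ℂ (R.chi μ (sTarget x p).1.2 (sTarget x p).1.1) := by
  obtain ⟨⟨g, h⟩, hc⟩ := p
  have h1 := R.chi_conj μ hc x
  have h2 := R.chi_inv μ (sTarget x ⟨(g, h), hc⟩).2.symm
  have h3 := congrArg (fun z : Circle => (z : ℂ)) (sPhase_mul_beta hα hc x)
  simp only [sTarget, Circle.coe_mul] at h1 h2 h3 ⊢
  rw [show (x * h⁻¹ * x⁻¹)⁻¹ = x * h * x⁻¹ by group, h1, ← h3] at h2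
  -- `h2` now evaluates the character at $xhx^{-1}$ in two ways, by conjugation and by inversion;
  -- both carry this same factor.
  refine mul_left_cancel₀ (Circle.coe_ne_zero
    (beta α (x * g * x⁻¹) (x * h⁻¹ * x⁻¹) (x * h * x⁻¹))) ?_
  rw [← h2]
  ring

theorem sTarget_injective (x : G) : Function.Injective (sTarget (G := G) x) := by
  rintro ⟨⟨g, h⟩, _⟩ ⟨⟨g', h'⟩, _⟩ e
  simpa [sTarget, and_comm] using e

/-! ### The action of $S$ on the vectors $|A,\mu\rangle$ -/

variable [Fintype G] [DecidableEq G]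

/-- Removing the class condition matters because `sTarget x` moves it from the first entry to the
second; the unrestricted sum can be reindexed freely. -/
theorem IrrepSystem.ket_eq_sum (R : IrrepSystem.{u, v} α) {A : ConjClasses G} (μ : R.Label A) :
    R.ket μ = (1 / (Real.sqrt (Fintype.card G : ℝ) : ℂ)) •
      ∑ p : CommPair G, R.chi μ p.1.1 p.1.2 • basisKet p := by
  rw [ket, Finset.sum_filter_of_ne]
  intro p _ hp
  by_contra hA
  exact hp (by rw [R.chi_eq_zero μ hA, zero_smul])

theorem sOpAt_basisKet (x : G) (p : CommPair G) :
    sOpAt α x (basisKet p) = (sPhase α x p.1.1 p.1.2 : ℂ) • basisKet (sTarget x p) := by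
  have := (EuclideanSpace.basisFun (CommPair G) ℂ).toBasis.constr_basis ℂ
    (fun p => (sPhase α x p.1.1 p.1.2 : ℂ) • basisKet (sTarget x p)) p
  rwa [OrthonormalBasis.coe_toBasis, EuclideanSpace.basisFun_apply] at this

theorem sOpAt_ket (hα : IsNormalizedCocycle α) (R : IrrepSystem.{u, v} α) {A : ConjClasses G}
    (μ : R.Label A) (x : G) :
    sOpAt α x (R.ket μ) = (1 / (Real.sqrt (Fintype.card G : ℝ) : ℂ)) •
      ∑ p : CommPair G, starRingEnd ℂ (R.chi μ p.1.2 p.1.1) • basisKet p := by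
  rw [R.ket_eq_sum, map_smul, map_sum]
  congr 1
  -- An injective self-map of a finite set is a permutation. Reindexing by it absorbs all dependence
  -- on `x`.
  rw [← (Finite.injective_iff_bijective.1 (sTarget_injective x)).sum_comp
    fun p => starRingEnd ℂ (R.chi μ p.1.2 p.1.1) • basisKet p]
  refine Finset.sum_congr rfl fun p _ => ?_
  rw [map_smul, sOpAt_basisKet, smul_smul, mul_comm, R.sPhase_mul_chi hα]

theorem sOp_ket (hα : IsNormalizedCocycle α) (R : IrrepSystem.{u, v} α) {A : ConjClasses G}
    (μ : R.Label A) :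
    sOp α (R.ket μ) = (1 / (Real.sqrt (Fintype.card G : ℝ) : ℂ)) •
      ∑ p : CommPair G, starRingEnd ℂ (R.chi μ p.1.2 p.1.1) • basisKet p := by
  have hG : (Fintype.card G : ℂ) ≠ 0 := Nat.cast_ne_zero.2 Fintype.card_ne_zero
  rw [sOp, LinearMap.smul_apply, LinearMap.sum_apply,
    Finset.sum_congr rfl fun x _ => sOpAt_ket hα R μ x, Finset.sum_const, Finset.card_univ,
    ← Nat.cast_smul_eq_nsmul ℂ, smul_smul, one_div_mul_cancel hG, one_smul]

theorem inner_sum_basisKet (f k : CommPair G → ℂ) :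
    inner ℂ (∑ p, f p • basisKet p) (∑ p, k p • basisKet p) =
      ∑ p, starRingEnd ℂ (f p) * k p := by
  have := (EuclideanSpace.basisFun (CommPair G) ℂ).orthonormal.inner_sum f k Finset.univ
  simpa only [EuclideanSpace.basisFun_apply, basisKet] using this

end TwistedDouble

theorem mainTheorem4 {G : Type*} [Group G] [Fintype G] [DecidableEq G]
    (α : G → G → G → Circle) (hα : TwistedDouble.IsNormalizedCocycle α)
    (R : TwistedDouble.IrrepSystem α) (A B : ConjClasses G) (μ : R.Label A) (ν : R.Label B) :
    R.sMatrix μ ν =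
      (1 / (Fintype.card G : ℂ)) *
        ∑ p : G × G with
            ConjClasses.mk p.1 = A ∧ ConjClasses.mk p.2 = B ∧ p.1 * p.2 = p.2 * p.1,
          starRingEnd ℂ (R.chi μ p.1 p.2) * starRingEnd ℂ (R.chi ν p.2 p.1) := by
  have hs : (Real.sqrt (Fintype.card G : ℝ) : ℂ) * Real.sqrt (Fintype.card G : ℝ) =
      Fintype.card G := by
    rw [← Complex.ofReal_mul, Real.mul_self_sqrt (Nat.cast_nonneg _), Complex.ofReal_natCast]
  rw [TwistedDouble.IrrepSystem.sMatrix, TwistedDouble.sOp_ket hα, R.ket_eq_sum, inner_smul_left,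
    inner_smul_right, TwistedDouble.inner_sum_basisKet, ← mul_assoc, map_div₀, map_one,
    Complex.conj_ofReal, one_div_mul_one_div, hs]
  congr 1
  have e : ∀ p : G × G,
      (ConjClasses.mk p.1 = A ∧ ConjClasses.mk p.2 = B ∧ p.1 * p.2 = p.2 * p.1) ↔
        p.1 * p.2 = p.2 * p.1 ∧ ConjClasses.mk p.1 = A ∧ ConjClasses.mk p.2 = B := fun p => by
    tauto
  simp only [e]
  -- The class conditions are dropped because the characters vanish off their classes; the
  -- commutation condition remains and becomes the subtype `CommPair`.
  rw [← Finset.filter_filter, Finset.sum_filter_of_ne]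
  · exact (Finset.sum_subtype _ (fun p => by simp)
      fun p : G × G => starRingEnd ℂ (R.chi μ p.1 p.2) * starRingEnd ℂ (R.chi ν p.2 p.1)).symm
  · intro p _ hp
    constructor <;> by_contra hA <;> exact hp (by simp [R.chi_eq_zero _ hA])
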